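/- **Setting.** Let $V$ be a finite set of $n$ spins with a metric $\mathsf d$, and let $\mathcal H=(\mathbb C^q)^{\otimes V}$. A state is a positive semidefinite operator $\omega$ on $\mathcal H$ with $\mathrm{Tr}\,\omega=1$; write $\langle X\rangle=\mathrm{Tr}[\omega X]$ and let $\|\cdot\|$ be the operator norm. For $\Lambda\subseteq V$ let $\mathcal O_\Lambda$ be the set of self-adjoint operators on $\mathcal H$ that act only on the spins in $\Lambda$. An operator is $k$-local if it is a sum of operators each acting on at most $k$ spins. **Local norms.** For a family $h=(h_\Lambda)_{\Lambda\subseteq V}$ with $h_\Lambda\in\mathcal O_\Lambda$ put $\partial(h)=2\max_{x\in V}\sum_{\Lambda\ni x}\|h_\Lambda\|$. For a self-adjoint $H$ let $$\|H\|_{\mathrm{loc}}=\min\Big\{\partial(h):H=\sum_{\Lambda\subseteq V}h_\Lambda,\ h_\Lambda\in\mathcal O_\Lambda\Big\},$$ and for a $k$-local self-adjoint $H$ let $$\|H\|_{\mathrm{loc},k}=\min\Big\{\partial(h):H=\sum_{\Lambda\subseteq V,\ |\Lambda|\le k}h_\Lambda,\ h_\Lambda\in\mathcal O_\Lambda\Big\}.$$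 **Hypotheses.** Let $A>0$, $d\ge1$, $r_0>0$ be such that $|\{x\in V:\mathsf d(x,v)\le r\}|\le A\,r^d$ for all $v\in V$ and all $r\ge r_0$. Let $\omega$ be a state with correlation length $\xi>0$ and constant $C>0$, i.e. for all disjoint nonempty $\Lambda_1,\Lambda_2\subseteq V$ and all $h_1\in\mathcal O_{\Lambda_1}$, $h_2\in\mathcal O_{\Lambda_2}$, $$|\langle h_1h_2\rangle-\langle h_1\rangle\langle h_2\rangle|\le C\,\|h_1\|\,\|h_2\|\,e^{-\mathsf d(\Lambda_1,\Lambda_2)/\xi},\qquad \mathsf d(\Lambda_1,\Lambda_2)=\min_{x\in\Lambda_1,\,y\in\Lambda_2}\mathsf d(x,y).$$ **Theorem.** For every integer $k\ge1$, every $k$-local self-adjoint $H$ and every real $l\ge r_0$, the inequality $$\langle e^H\rangle\le\exp\Big[\langle H\rangle+\frac nk\Big(e^{k(Al^d)^2L}-1-\frac{k(Al^d)^2L}{2}\Big)L\Big]+C\,e^{\langle H\rangle+nL-l/\xi}$$ holds with $L=\|H\|_{\mathrm{loc},k}$. It also holds with $L=\|H\|_{\mathrm{loc}}$ whenever the minimum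 defining $\|H\|_{\mathrm{loc}}$ is attained by a decomposition with $h_\Lambda=0$ for all $|\Lambda|>k$. -/

import Mathlib

open scoped Matrix.Norms.L2Operator ComplexOrder

noncomputable section

namespace SpinSystem

/-- Computational basis of `(ℂ^q)^{⊗V}`, the Hilbert space of a finite set `V` of spins. -/
abbrev Config (V : Type*) (q : ℕ) := V → Fin q

/-- Linear operators on `(ℂ^q)^{⊗V}` as matrices in the computational basis. The norm `‖X‖` of an
operator is the operator norm induced by the Hilbert space norm, and `NormedSpace.exp X` is the
operator exponential. -/
abbrev Op (V : Type*) (q : ℕ) := Matrix (Config V q) (Config V q) ℂ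

section

variable {V : Type*} [Fintype V] [DecidableEq V] {q : ℕ}

/-- `embed Λ a = a ⊗ 1`: the operator `a` on the spins in `Λ`, as an operator on all the spins. -/
def embed (Λ : Finset V) (a : Op Λ q) : Op V q :=
  Matrix.of fun s t => if ∀ x, x ∉ Λ → s x = t x then a (fun x => s x) (fun x => t x) else 0

/-- `X` acts only on the spins in `Λ`. -/
def ActsOn (Λ : Finset V) (X : Op V q) : Prop :=
  ∃ a : Op Λ q, X = embed Λ a

/-- `X` is an observable of the region `Λ`: it is self-adjoint and acts only on `Λ`. -/
def IsObservableOn (Λ : Finset V) (X : Op V q) : Prop :=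
  X.IsHermitian ∧ ActsOn Λ X

/-- Quantum states: positive semidefinite operators with unit trace. -/
def IsState (ω : Op V q) : Prop :=
  ω.PosSemidef ∧ ω.trace = 1

/-- The expectation value `⟨X⟩ = Tr[ω X]`. -/
def expectation (ω X : Op V q) : ℂ :=
  (ω * X).trace

/-- `X` is a sum of operators each of which acts on at most `k` spins. -/
def IsKLocal (k : ℕ) (X : Op V q) : Prop :=
  ∃ Y : Finset V → Op V q,
    (∀ Λ, ActsOn Λ (Y Λ)) ∧ X = ∑ Λ ∈ Finset.univ.filter (fun Λ : Finset V => Λ.card ≤ k), Y Λ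

/-- Decompositions `H = ∑_Λ h_Λ` of `H` into observables `h_Λ` of the regions `Λ`. -/
def decompositions (H : Op V q) : Set (Finset V → Op V q) :=
  {h | (∀ Λ, IsObservableOn Λ (h Λ)) ∧ H = ∑ Λ, h Λ}

/-- Decompositions of `H` in which only regions with at most `k` spins contribute. -/
def kLocalDecompositions (k : ℕ) (H : Op V q) : Set (Finset V → Op V q) :=
  {h | h ∈ decompositions H ∧ ∀ Λ : Finset V, k < Λ.card → h Λ = 0}

/-- Twice the largest dependence `max_x ∑_{Λ ∋ x} ‖h_Λ‖` of a decomposition on a spin. -/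
def dependence (h : Finset V → Op V q) : ℝ :=
  2 * ⨆ x : V, ∑ Λ ∈ Finset.univ.filter (fun Λ : Finset V => x ∈ Λ), ‖h Λ‖

/-- The local norm, with the minimum over all decompositions. -/
def localNorm (H : Op V q) : ℝ :=
  sInf (dependence '' decompositions H)

/-- The local norm of a `k`-local observable, with the minimum over its decompositions into
observables of at most `k` spins each. -/
def kLocalNorm (k : ℕ) (H : Op V q) : ℝ :=
  sInf (dependence '' kLocalDecompositions k H)

variable [MetricSpace V]

/-- The distance `min {dist x y : x ∈ Λ₁, y ∈ Λ₂}` of two nonempty regions. -/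
def regionDist (Λ₁ Λ₂ : Finset V) : ℝ :=
  ⨅ p : Λ₁ × Λ₂, dist (p.1 : V) (p.2 : V)

/-- The balls of radius `r ≥ r₀` contain at most `A r ^ d` spins. -/
def BallGrowth (V : Type*) [Fintype V] [MetricSpace V] (A d r₀ : ℝ) : Prop :=
  ∀ (v : V) (r : ℝ), r₀ ≤ r → ((Metric.closedBall v r).ncard : ℝ) ≤ A * r ^ d

/-- The correlations of `ω` decay exponentially with correlation length `ξ` and constant `C`. -/
def HasCorrelationLength (ω : Op V q) (ξ C : ℝ) : Prop :=
  ∀ Λ₁ Λ₂ : Finset V, Λ₁.Nonempty → Λ₂.Nonempty → Disjoint Λ₁ Λ₂ →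
    ∀ h₁ h₂ : Op V q, IsObservableOn Λ₁ h₁ → IsObservableOn Λ₂ h₂ →
      ‖expectation ω (h₁ * h₂) - expectation ω h₁ * expectation ω h₂‖ ≤
        C * ‖h₁‖ * ‖h₂‖ * Real.exp (-(regionDist Λ₁ Λ₂ / ξ))

end

/-- The right-hand side of the bound, for `n` spins, locality `k`, mean value `m = ⟨H⟩` and local
norm `L`. -/
def momentBound (n k : ℕ) (A d ξ C l m L : ℝ) : ℝ :=
  Real.exp (m + (n : ℝ) / k *
      (Real.exp (k * (A * l ^ d) ^ 2 * L) - 1 - k * (A * l ^ d) ^ 2 * L / 2) * L)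
    + C * Real.exp (m + n * L - l / ξ)

end SpinSystem

end

/-! Centre the terms: with g_Λ = h_Λ - ⟨h_Λ⟩, the operator e^H is e^⟨H⟩ times the exponential of ∑
g_Λ. Since ‖g_Λ‖ ≤ 2‖h_Λ‖, the weights ‖g_Λ‖ at each spin sum to at most L; this is what the factor
2 in `dependence` pays for. Expand ⟨(∑ g_Λ)^m⟩ over m-tuples of regions.

If some region of a tuple is farther than l from all the others, its centred factor commutes to the
front and decay of correlations bounds the mean by C e^{-l/ξ} times the product of the norms. Over
all tuples and all m, with weights 1/m!, this gives the additive term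
(`norm_expectation_prod_le_of_not_linked`).

The other tuples are bounded by norms and counted through "near" graphs without isolated vertices.
Such a graph contains, around any vertex, a star whose deletion isolates nobody
(`Linked.exists_star`), so iterating covers it by disjoint stars. A star with j leaves has total
weight at most (n/k) L (kML)^j, where M = A l^d (`starSum_near_le`). The exponential generating
function of star forests is the exponential of that of stars, which produces e^y - 1 - y/2 with y =
kML (`linkedSum_succ_le`, `sum_div_factorial_le_exp`). As M ≥ 1, replacing M by M² only weakens the
bound. -/

namespace SpinSystem

/-! ### Tuples without isolated members -/

section Linked

open Finset

/-- Every member of the family `f` is related to some other member. -/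
def Linked {α ι : Type*} (R : ι → ι → Prop) (f : α → ι) : Prop :=
  ∀ i, ∃ j, j ≠ i ∧ R (f i) (f j)

/-- A family without isolated members contains, around any given member `v`, a star whose removal
does not create isolated members. -/
theorem Linked.exists_star {α ι : Type*} [Fintype α] [DecidableEq α] {R : ι → ι → Prop}
    (hR : ∀ ⦃x y⦄, R x y → R y x) {f : α → ι} (hf : Linked R f) (v : α) :
    ∃ U : Finset α, v ∈ U ∧ 2 ≤ #U ∧ ∃ c ∈ U, (∀ i ∈ U, i ≠ c → R (f c) (f i)) ∧
      Linked R (fun i : {i // i ∉ U} => f i) := by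
  classical
  obtain ⟨u, huv, hvu⟩ := hf v
  -- `I` collects the members that would become isolated if `v` and `u` were removed.
  set I : Finset α := univ.filter fun i => i ≠ v ∧ i ≠ u ∧ ∀ j, j ≠ i → R (f i) (f j) →
    j = v ∨ j = u with hI
  have memI : ∀ i, i ∈ I ↔ i ≠ v ∧ i ≠ u ∧ ∀ j, j ≠ i → R (f i) (f j) → j = v ∨ j = u := by
    simp [hI]
  have hadj : ∀ i ∈ I, R (f v) (f i) ∨ R (f u) (f i) := by
    intro i hi
    obtain ⟨j, hj, hij⟩ := hf i
    rcases ((memI i).1 hi).2.2 j hj hij with rfl | rfl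
    · exact Or.inl (hR hij)
    · exact Or.inr (hR hij)
  have hout : ∀ i, i ∉ I → i ≠ v → i ≠ u → ∃ j, j ≠ i ∧ R (f i) (f j) ∧ j ∉ I ∧ j ≠ v ∧ j ≠ u := by
    intro i hi hiv hiu
    rw [memI] at hi
    push Not at hi
    obtain ⟨j, hj, hij, hjv, hju⟩ := hi hiv hiu
    refine ⟨j, hj, hij, fun hjI => ?_, hjv, hju⟩
    rcases ((memI j).1 hjI).2.2 i hj.symm (hR hij) with h | h
    exacts [hiv h, hiu h]
  have hfull : Linked R (fun i : {i // i ∉ insert v (insert u I)} => f i) := by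
    rintro ⟨i, hi⟩
    simp only [mem_insert, not_or] at hi
    obtain ⟨j, hj, hij, hjI, hjv, hju⟩ := hout i hi.2.2 hi.1 hi.2.1
    exact ⟨⟨j, by simp [hjI, hjv, hju]⟩, fun h => hj (congrArg Subtype.val h), hij⟩
  have hcard : 2 ≤ #(insert v (insert u I)) := by
    have : #({v, u} : Finset α) ≤ #(insert v (insert u I)) :=
      card_le_card (by intro x; simp; tauto)
    rwa [card_pair huv.symm] at this
  by_cases h1 : ∀ i ∈ I, R (f v) (f i)
  · refine ⟨insert v (insert u I), by simp, hcard, v, by simp, ?_, hfull⟩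
    intro i hi hiv
    simp only [mem_insert] at hi
    rcases hi with rfl | rfl | hi
    exacts [absurd rfl hiv, hvu, h1 i hi]
  · by_cases h2 : ∀ i ∈ I, R (f u) (f i)
    · refine ⟨insert v (insert u I), by simp, hcard, u, by simp, ?_, hfull⟩
      intro i hi hiu
      simp only [mem_insert] at hi
      rcases hi with rfl | rfl | hi
      exacts [hR hvu, absurd rfl hiu, h2 i hi]
    -- Neither end reaches all of `I`. Remove `v` with its neighbours in `I`: the rest of `I` stays
    -- attached to `u`, and `u` itself keeps `p`.
    · push Not at h1 h2
      obtain ⟨p, hpI, hpv⟩ := h1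
      obtain ⟨r, hrI, hru⟩ := h2
      have hpu : R (f u) (f p) := (hadj p hpI).resolve_left hpv
      have hrv : R (f v) (f r) := (hadj r hrI).resolve_right hru
      refine ⟨insert v (I.filter fun i => R (f v) (f i)), by simp, ?_, v, by simp, ?_, ?_⟩
      · have : #({v, r} : Finset α) ≤ #(insert v (I.filter fun i => R (f v) (f i))) :=
          card_le_card (by
            intro x
            simp only [mem_insert, mem_singleton, mem_filter]
            rintro (rfl | rfl)
            exacts [Or.inl rfl, Or.inr ⟨hrI, hrv⟩])
        rwa [card_pair ((memI r).1 hrI).1.symm] at this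
      · intro i hi hiv
        simp only [mem_insert, mem_filter] at hi
        exact (hi.resolve_left hiv).2
      · rintro ⟨i, hi⟩
        simp only [mem_insert, mem_filter, not_or, not_and] at hi
        have key : ∃ j, j ≠ i ∧ R (f i) (f j) ∧ j ≠ v ∧ (j ∈ I → ¬ R (f v) (f j)) := by
          by_cases hiI : i ∈ I
          · exact ⟨u, ((memI i).1 hiI).2.1.symm, hR ((hadj i hiI).resolve_left (hi.2 hiI)), huv,
              fun h => absurd rfl ((memI u).1 h).2.1⟩
          · by_cases hiu : i = u
            · subst hiu
              exact ⟨p, ((memI p).1 hpI).2.1, hpu, ((memI p).1 hpI).1, fun _ => hpv⟩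
            · obtain ⟨j, hj, hij, hjI, hjv, -⟩ := hout i hiI hi.1 hiu
              exact ⟨j, hj, hij, hjv, fun h => absurd h hjI⟩
        obtain ⟨j, hj, hij, hjv, hjI⟩ := key
        exact ⟨⟨j, by simpa [hjv] using hjI⟩, fun h => hj (congrArg Subtype.val h), hij⟩

/-- The number of stars that span `j + 1` labelled vertices, for `j ≥ 1`. -/
def starCount (j : ℕ) : ℕ := if j = 0 then 0 else if j = 1 then 1 else j + 1

open Classical in
/-- The total weight of the families `α → ι` without isolated members. -/
noncomputable def linkedSum {ι : Type*} [Fintype ι] (R : ι → ι → Prop) (w : ι → ℝ) (α : Type*) [Fintype α]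
    [DecidableEq α] : ℝ :=
  ∑ f : α → ι, if Linked R f then ∏ i, w (f i) else 0

theorem linkedSum_nonneg {ι : Type*} [Fintype ι] (R : ι → ι → Prop) {w : ι → ℝ}
    (hw : ∀ x, 0 ≤ w x) (α : Type*) [Fintype α] [DecidableEq α] : 0 ≤ linkedSum R w α := by
  classical
  refine sum_nonneg fun f _ => ?_
  split_ifs
  exacts [prod_nonneg fun i _ => hw _, le_rfl]

theorem linkedSum_congr {ι : Type*} [Fintype ι] (R : ι → ι → Prop) (w : ι → ℝ) {α β : Type*}
    [Fintype α] [Fintype β] [DecidableEq α] [DecidableEq β] (e : α ≃ β) : linkedSum R w α = linkedSum R w β := by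
  classical
  refine Fintype.sum_equiv (e.arrowCongr (Equiv.refl ι)) _ _ fun f => ?_
  have h1 : Linked R ((e.arrowCongr (Equiv.refl ι)) f) ↔ Linked R f := by
    constructor
    · intro h i
      obtain ⟨j, hj, hij⟩ := h (e i)
      refine ⟨e.symm j, fun h => hj (by simp [← h]), by simpa using hij⟩
    · intro h i
      obtain ⟨j, hj, hij⟩ := h (e.symm i)
      refine ⟨e j, fun h => hj (by simp [← h]), by simpa using hij⟩
  have h2 : ∏ i, w ((e.arrowCongr (Equiv.refl ι)) f i) = ∏ i, w (f i) :=
    Fintype.prod_equiv e.symm _ _ fun i => by simp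
  simp only [h1, h2]

theorem sum_mul_sum_restrict {ι α : Type*} [Fintype ι] [Fintype α] [DecidableEq α] (p : α → Prop)
    [DecidablePred p] [Fintype {i // p i}] [Fintype {i // ¬ p i}]
    [DecidableEq {i // p i}] [DecidableEq {i // ¬ p i}] (F : ({i // p i} → ι) → ℝ)
    (G : ({i // ¬ p i} → ι) → ℝ) :
    ∑ f : α → ι, F (fun i => f i) * G (fun i => f i) = (∑ g, F g) * ∑ g, G g := by
  rw [sum_mul_sum, ← Fintype.sum_prod_type' (f := fun g g' => F g * G g')]
  exact Fintype.sum_equiv (Equiv.piEquivPiSubtypeProd p fun _ => ι) _ _ fun f => rfl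

open Classical in
/-- The total weight of the families `α → ι` in which every member is related to the one at `c`. -/
noncomputable def starSum {ι α : Type*} [Fintype ι] [Fintype α] [DecidableEq α] (R : ι → ι → Prop)
    (w : ι → ℝ) (c : α) : ℝ :=
  ∑ f : α → ι, if ∀ i, i ≠ c → R (f c) (f i) then ∏ i, w (f i) else 0

-- Once the value at the centre is fixed, the remaining values are chosen independently among those
-- related to it.
open Classical in
theorem starSum_eq {ι α : Type*} [Fintype ι] [Fintype α] [DecidableEq α] (R : ι → ι → Prop)
    (w : ι → ℝ) (c : α) :
    starSum R w c = ∑ x, w x * (∑ y with R x y, w y) ^ (Fintype.card α - 1) := by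
  rw [starSum]
  rw [← (Equiv.funSplitAt c ι).symm.sum_comp, Fintype.sum_prod_type]
  refine sum_congr rfl fun x _ => ?_
  have hc : Fintype.card α - 1 = Fintype.card {j // j ≠ c} := by
    simp [Fintype.card_subtype_compl]
  rw [hc, ← Finset.card_univ, ← prod_const, Finset.prod_univ_sum, mul_sum, ← Finset.sum_subset
    (subset_univ (Fintype.piFinset fun _ : {j // j ≠ c} => univ.filter (R x)))]
  · refine sum_congr rfl fun g hg => ?_
    have : Subsingleton {j // ¬ j ≠ c} :=
      ⟨fun i j => Subtype.ext ((not_not.1 i.2).trans (not_not.1 j.2).symm)⟩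
    rw [if_pos, ← Fintype.prod_subtype_mul_prod_subtype (fun i => i ≠ c), mul_comm]
    · congr 1
      · rw [Fintype.prod_subsingleton _ (⟨c, by simp⟩ : {j // ¬ j ≠ c})]
        simp [Equiv.funSplitAt, Equiv.piSplitAt]
      · refine prod_congr rfl fun i _ => ?_
        simp [Equiv.funSplitAt, Equiv.piSplitAt, i.2]
    · intro i hi
      have := (Fintype.mem_piFinset.1 hg) ⟨i, hi⟩
      simpa [Equiv.funSplitAt, Equiv.piSplitAt, hi] using this
  · intro g _ hg
    rw [if_neg]
    intro h
    refine hg (Fintype.mem_piFinset.2 fun i => ?_)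
    simpa [Equiv.funSplitAt, Equiv.piSplitAt, i.2] using h i i.2

open Classical in
theorem sum_star_and_linked {ι α : Type*} [Fintype ι] [Fintype α] [DecidableEq α]
    (R : ι → ι → Prop) (w : ι → ℝ) (p : α → Prop) [DecidablePred p] [Fintype {i // p i}]
    [Fintype {i // ¬ p i}] [DecidableEq {i // p i}] [DecidableEq {i // ¬ p i}] {c : α} (hc : p c) :
    (∑ f : α → ι, if (∀ i, p i → i ≠ c → R (f c) (f i)) ∧ Linked R (fun i : {i // ¬ p i} => f i)
      then ∏ i, w (f i) else 0) =
      starSum R w (⟨c, hc⟩ : {i // p i}) * linkedSum R w {i // ¬ p i} := by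
  rw [starSum, linkedSum, ← sum_mul_sum_restrict]
  refine sum_congr rfl fun f _ => ?_
  have hprod : ∏ i, w (f i) = (∏ i : {i // p i}, w (f i)) * ∏ i : {i // ¬ p i}, w (f i) := by
    rw [← Fintype.prod_subtype_mul_prod_subtype p (fun i => w (f i))]
    congr!
  have hs : (∀ i, p i → i ≠ c → R (f c) (f i)) ↔
      ∀ i : {i // p i}, i ≠ ⟨c, hc⟩ → R (f c) (f i) := by
    simp only [Subtype.forall, ne_eq, Subtype.mk.injEq]
  simp only [hprod, hs, ite_and, ite_mul, zero_mul, mul_ite, mul_zero]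
  split_ifs <;> rfl

/-- Member 0 lies in a removable star and what remains is again linked, so a union bound over the
star's other members `W` and its centre applies. There are `m.choose j` sets `W` of size `j`. -/
theorem linkedSum_succ_le {ι : Type*} [Fintype ι] {R : ι → ι → Prop} (hR : ∀ ⦃x y⦄, R x y → R y x) {w : ι → ℝ}
    (hw : ∀ x, 0 ≤ w x) {B : ℕ → ℝ}
    (hB : ∀ j, 1 ≤ j → ∀ (α : Type) [Fintype α] [DecidableEq α] (c : α), Fintype.card α = j + 1 → starSum R w c ≤ B j) (m : ℕ) :
    linkedSum R w (Fin (m + 1)) ≤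
      ∑ j ∈ range (m + 1), m.choose j * (starCount j * B j * linkedSum R w (Fin (m - j))) := by
  classical
  -- Admissible centres. Either end of a two-vertex star can serve as centre, so only 0 is listed;
  -- avoiding this double count is the source of the final `- y / 2`.
  set G : Finset (Fin (m + 1)) → Finset (Fin (m + 1)) := fun W =>
    if #W = 1 then {0} else insert 0 W with hG
  set star : Finset (Fin (m + 1)) → Fin (m + 1) → (Fin (m + 1) → ι) → Prop := fun W c f =>
    ∀ i ∈ insert 0 W, i ≠ c → R (f c) (f i) with hstar
  set P : Finset (Finset (Fin (m + 1))) := (univ.erase (0 : Fin (m + 1))).powerset with hP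
  have hGsub : ∀ W, G W ⊆ insert 0 W := by
    intro W
    simp only [hG]
    split_ifs
    · simp
    · exact subset_rfl
  have hpt : ∀ f : Fin (m + 1) → ι, (if Linked R f then ∏ i, w (f i) else 0) ≤
      ∑ W ∈ P with W.Nonempty, ∑ c ∈ G W,
        if star W c f ∧ Linked R (fun i : {i // i ∉ insert 0 W} => f i) then ∏ i, w (f i)
        else 0 := by
    intro f
    have hpr : 0 ≤ ∏ i, w (f i) := prod_nonneg fun i _ => hw _
    have hnn : ∀ W c, 0 ≤ if star W c f ∧ Linked R (fun i : {i // i ∉ insert 0 W} => f i) then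
        ∏ i, w (f i) else 0 := by
      intro W c
      split_ifs
      exacts [hpr, le_rfl]
    split_ifs with hf
    swap
    · exact sum_nonneg fun W _ => sum_nonneg fun c _ => hnn W c
    obtain ⟨U, h0, hU, c, hc, hs, hl⟩ := hf.exists_star hR 0
    obtain ⟨W, hW0, rfl⟩ : ∃ W, 0 ∉ W ∧ U = insert 0 W :=
      ⟨U.erase 0, by simp, by simp [insert_erase h0]⟩
    rw [card_insert_of_notMem hW0] at hU
    have hWP : W ∈ P.filter Finset.Nonempty := by
      simp only [hP, mem_filter, mem_powerset, subset_erase]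
      exact ⟨⟨subset_univ _, hW0⟩, card_pos.1 (by omega)⟩
    obtain ⟨c', hc', hs'⟩ : ∃ c' ∈ G W, star W c' f := by
      by_cases h1 : #W = 1
      · refine ⟨0, by simp [hG, h1], ?_⟩
        obtain ⟨u, rfl⟩ := card_eq_one.1 h1
        intro i hi hi0
        have hiu : i = u := by simpa [hi0] using hi
        subst hiu
        simp only [mem_insert, mem_singleton] at hc
        rcases hc with rfl | rfl
        · exact hs _ (by simp) hi0
        · exact hR (hs 0 (by simp) hi0.symm)
      · exact ⟨c, by simpa [hG, h1] using hc, hs⟩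
    refine le_trans ?_ (single_le_sum (f := fun W => ∑ c ∈ G W,
        if star W c f ∧ Linked R (fun i : {i // i ∉ insert 0 W} => f i) then ∏ i, w (f i)
        else 0) (fun W _ => sum_nonneg fun c _ => hnn W c) hWP)
    refine le_trans ?_ (single_le_sum (fun c _ => hnn W c) hc')
    rw [if_pos ⟨hs', hl⟩]
  have hfac : ∀ W ∈ P, W.Nonempty → ∀ c ∈ insert 0 W,
      (∑ f : Fin (m + 1) → ι,
        if star W c f ∧ Linked R (fun i : {i // i ∉ insert 0 W} => f i) then ∏ i, w (f i)
        else 0) ≤ B #W * linkedSum R w (Fin (m - #W)) := by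
    intro W hW hne c hc
    have hW0 : 0 ∉ W := by
      simp only [hP, mem_powerset, subset_erase] at hW
      exact hW.2
    have hcardW : Fintype.card ↥(insert 0 W) = #W + 1 := by
      rw [Fintype.card_coe, card_insert_of_notMem hW0]
    have e : {i // i ∉ insert 0 W} ≃ Fin (m - #W) := Fintype.equivFinOfCardEq (by
      rw [Fintype.card_of_subtype (insert 0 W)ᶜ (by simp), card_compl, card_insert_of_notMem hW0,
        Fintype.card_fin]
      omega)
    rw [← linkedSum_congr R w e]
    refine le_trans (le_of_eq ?_) (mul_le_mul_of_nonneg_right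
      (hB (#W) (card_pos.2 hne) ↥(insert 0 W) ⟨c, hc⟩ hcardW) (linkedSum_nonneg R hw _))
    convert sum_star_and_linked R w (fun i => i ∈ insert 0 W) hc
  calc linkedSum R w (Fin (m + 1))
      ≤ ∑ f : Fin (m + 1) → ι, ∑ W ∈ P with W.Nonempty, ∑ c ∈ G W,
        if star W c f ∧ Linked R (fun i : {i // i ∉ insert 0 W} => f i) then ∏ i, w (f i)
        else 0 := by
          rw [linkedSum]
          exact sum_le_sum fun f _ => hpt f
    _ = ∑ W ∈ P with W.Nonempty, ∑ c ∈ G W, ∑ f : Fin (m + 1) → ι,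
        if star W c f ∧ Linked R (fun i : {i // i ∉ insert 0 W} => f i) then ∏ i, w (f i)
        else 0 := by
      rw [sum_comm]
      exact sum_congr rfl fun W _ => sum_comm
    _ ≤ ∑ W ∈ P with W.Nonempty, ∑ c ∈ G W, B #W * linkedSum R w (Fin (m - #W)) := by
      refine sum_le_sum fun W hW => sum_le_sum fun c hc => ?_
      rw [mem_filter] at hW
      exact hfac W hW.1 hW.2 c (hGsub W hc)
    _ = ∑ W ∈ P, starCount #W * B #W * linkedSum R w (Fin (m - #W)) := by
      rw [sum_filter]
      refine sum_congr rfl fun W hW => ?_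
      have hW0 : 0 ∉ W := by
        simp only [hP, mem_powerset, subset_erase] at hW
        exact hW.2
      split_ifs with h
      · have h0 : #W ≠ 0 := (card_pos.2 h).ne'
        rw [sum_const, nsmul_eq_mul, mul_assoc]
        congr 2
        by_cases h1 : #W = 1
        · simp [hG, starCount, h1]
        · simp only [hG, starCount, h1, h0, if_false]
          exact card_insert_of_notMem hW0
      · rw [not_nonempty_iff_eq_empty] at h
        simp [h, starCount]
    _ = _ := by
      rw [hP, sum_powerset_apply_card (fun j => starCount j * B j * linkedSum R w (Fin (m - j)))]
      simp [nsmul_eq_mul]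

end Linked

/-! ### The exponential generating function of star forests -/

section Generating

open Finset

/-- Without the exceptional value at `j = 1` the series ∑_{j ≥ 1} (j+1) x^j / j! is the derivative
of x(e^x - 1); the correction from 2 to 1 subtracts x. -/
theorem sum_starCount_le {x : ℝ} (hx : 0 ≤ x) (N : ℕ) :
    ∑ j ∈ range N, starCount j * x ^ j / j.factorial ≤
      (Real.exp x - 1) + x * Real.exp x - x := by
  -- Starting at `N + 2` places both exceptional values of `starCount`, at 0 and 1, in the base
  -- case.
  have hid : ∀ N : ℕ, ∑ j ∈ range (N + 2), starCount j * x ^ j / j.factorial =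
      (∑ j ∈ range (N + 2), x ^ j / j.factorial) - 1
        + x * (∑ j ∈ range (N + 1), x ^ j / j.factorial) - x := by
    intro N
    induction N with
    | zero => simp [sum_range_succ, starCount]
    | succ N ih =>
      rw [sum_range_succ, ih, sum_range_succ _ (N + 2), sum_range_succ _ (N + 1)]
      have h : (starCount (N + 2) : ℝ) = N + 2 + 1 := by simp [starCount]
      have hf : ((N + 2).factorial : ℝ) = (N + 2) * (N + 1).factorial := by
        rw [Nat.factorial_succ]
        push_cast
        ring
      have h0 : ((N + 1).factorial : ℝ) ≠ 0 := by positivity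
      have h2 : (N : ℝ) + 2 ≠ 0 := by positivity
      rw [h, hf]
      field_simp
      ring
  calc ∑ j ∈ range N, starCount j * x ^ j / j.factorial
      ≤ ∑ j ∈ range (N + 2), starCount j * x ^ j / j.factorial :=
        sum_le_sum_of_subset_of_nonneg (range_mono (by omega)) fun _ _ _ => by positivity
    _ ≤ _ := by
      rw [hid]
      have h1 := Real.sum_le_exp_of_nonneg hx (N + 2)
      have h2 := mul_le_mul_of_nonneg_left (Real.sum_le_exp_of_nonneg hx (N + 1)) hx
      linarith

/-- The recursion says that the generating function satisfies P' ≤ S' P, with S the generating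
function of weighted stars. Hence P e^{-S} decreases on [0, ∞), and comparing 0 with 1 gives the
bound. Truncating P to a polynomial avoids any question of convergence. -/
theorem sum_div_factorial_le_exp {T : ℕ → ℝ} (hT : ∀ m, 0 ≤ T m) (h0 : T 0 ≤ 1) {a y : ℝ}
    (ha : 0 ≤ a) (hy : 0 ≤ y)
    (hrec : ∀ m, T (m + 1) ≤
      ∑ j ∈ range (m + 1), m.choose j * (starCount j * (a * y ^ j) * T (m - j))) (N : ℕ) :
    ∑ m ∈ range N, T m / m.factorial ≤ Real.exp (a * (Real.exp y - 1 - y / 2)) := by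
  set P : ℝ → ℝ := fun z => ∑ m ∈ range (N + 1), T m / m.factorial * z ^ m with hP
  set P' : ℝ → ℝ := fun z => ∑ m ∈ range N, T (m + 1) / m.factorial * z ^ m with hP'
  set S : ℝ → ℝ := fun z => a * (z * (Real.exp (y * z) - 1) - y * z ^ 2 / 2) with hS
  set S' : ℝ → ℝ := fun z =>
    a * ((Real.exp (y * z) - 1) + (y * z) * Real.exp (y * z) - y * z) with hS'
  have hPd : ∀ z, HasDerivAt P (P' z) z := by
    intro z
    have h : HasDerivAt P (∑ m ∈ range (N + 1), T m / m.factorial * (m * z ^ (m - 1))) z :=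
      HasDerivAt.fun_sum fun m _ => (hasDerivAt_pow m z).const_mul _
    convert h using 1
    rw [sum_range_succ', hP']
    simp only [Nat.cast_zero, zero_mul, mul_zero, add_zero, Nat.add_sub_cancel]
    refine sum_congr rfl fun m _ => ?_
    rw [Nat.factorial_succ]
    push_cast
    have : (m.factorial : ℝ) ≠ 0 := by positivity
    field_simp
  have hSd : ∀ z, HasDerivAt S (S' z) z := by
    intro z
    have h1 : HasDerivAt (fun z : ℝ => Real.exp (y * z)) (Real.exp (y * z) * (y * 1)) z :=
      ((hasDerivAt_id z).const_mul y).exp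
    have h2 := ((hasDerivAt_id z).mul (h1.sub_const 1)).sub
      (((hasDerivAt_pow 2 z).const_mul y).div_const 2)
    refine (h2.const_mul a).congr_deriv ?_
    simp only [hS', id]
    push_cast
    ring
  have hle : ∀ z, 0 ≤ z → P' z ≤ S' z * P z := by
    intro z hz
    set F : ℕ → ℝ := fun j => a * (starCount j * (y * z) ^ j / j.factorial) with hF
    set G : ℕ → ℝ := fun i => T i / i.factorial * z ^ i with hGd
    have hFn : ∀ j, 0 ≤ F j := fun j => by positivity
    have hGn : ∀ j, 0 ≤ G j := fun j => mul_nonneg (div_nonneg (hT j) (by positivity))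
      (pow_nonneg hz j)
    calc P' z ≤ ∑ m ∈ range N, ∑ j ∈ range (m + 1), F j * G (m - j) := by
          refine sum_le_sum fun m _ => ?_
          calc T (m + 1) / m.factorial * z ^ m
              ≤ (∑ j ∈ range (m + 1), m.choose j * (starCount j * (a * y ^ j) * T (m - j))) /
                  m.factorial * z ^ m := by
                have := hrec m
                gcongr
            _ = _ := by
                rw [sum_div, sum_mul]
                refine sum_congr rfl fun j hj => ?_
                have hjm : j ≤ m := by
                  rw [mem_range] at hj
                  omega
                rw [Nat.cast_choose ℝ hjm]
                simp only [hF, hGd]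
                have e1 : (m.factorial : ℝ) ≠ 0 := by positivity
                have e2 : (j.factorial : ℝ) ≠ 0 := by positivity
                have e3 : ((m - j).factorial : ℝ) ≠ 0 := by positivity
                have e4 : z ^ m = z ^ j * z ^ (m - j) := by rw [← pow_add]; congr 1; omega
                rw [e4, mul_pow]
                field_simp
      -- A truncated Cauchy product, next enlarged to the full rectangle since all terms are
      -- nonnegative.
      _ = ∑ m ∈ range N, ∑ j ∈ range (N - m), F m * G j :=
          sum_range_diag_flip N fun j i => F j * G i
      _ ≤ ∑ m ∈ range N, ∑ j ∈ range (N + 1), F m * G j := by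
          refine sum_le_sum fun m _ => sum_le_sum_of_subset_of_nonneg (range_mono (by omega)) ?_
          exact fun j _ _ => mul_nonneg (hFn m) (hGn j)
      _ = (∑ m ∈ range N, F m) * P z := by rw [sum_mul_sum]
      _ ≤ S' z * P z := by
          refine mul_le_mul_of_nonneg_right ?_ (sum_nonneg fun j _ => hGn j)
          rw [hF, ← mul_sum]
          exact mul_le_mul_of_nonneg_left (sum_starCount_le (mul_nonneg hy hz) N) ha
  have hgd : ∀ z, HasDerivAt (fun z => P z * Real.exp (-S z))
      (P' z * Real.exp (-S z) + P z * (Real.exp (-S z) * (-S' z))) z := fun z =>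
    (hPd z).mul (hSd z).neg.exp
  have hanti : AntitoneOn (fun z => P z * Real.exp (-S z)) (Set.Ici 0) := by
    refine antitoneOn_of_deriv_nonpos (convex_Ici 0)
      (fun z _ => (hgd z).continuousAt.continuousWithinAt)
      (fun z _ => (hgd z).differentiableAt.differentiableWithinAt) fun z hz => ?_
    rw [interior_Ici, Set.mem_Ioi] at hz
    rw [(hgd z).deriv]
    have := mul_le_mul_of_nonneg_right (hle z hz.le) (Real.exp_pos (-S z)).le
    linarith
  have hfin := hanti (a := 0) (b := 1) (by simp) (by simp) zero_le_one
  have hP0 : P 0 = T 0 := by simp [hP, sum_range_succ']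
  have hS0 : S 0 = 0 := by simp [hS]
  have hS1 : S 1 = a * (Real.exp y - 1 - y / 2) := by simp [hS]
  have hP1 : ∑ m ∈ range N, T m / m.factorial ≤ P 1 := by
    simp only [hP, one_pow, mul_one]
    exact sum_le_sum_of_subset_of_nonneg (range_mono (by omega))
      fun m _ _ => div_nonneg (hT m) (by positivity)
  simp only [hP0, hS0, neg_zero, Real.exp_zero, mul_one] at hfin
  rw [Real.exp_neg, ← div_eq_mul_inv, div_le_iff₀ (Real.exp_pos _)] at hfin
  calc _ ≤ P 1 := hP1
    _ ≤ T 0 * Real.exp (S 1) := hfin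
    _ ≤ 1 * Real.exp (S 1) := by gcongr
    _ = _ := by rw [one_mul, hS1]

end Generating

/-! ### Operators that act on a region -/

section Region

variable {V : Type*} [Fintype V] [DecidableEq V] {q : ℕ}

theorem embed_apply (Λ : Finset V) (a : Op Λ q) (s t : Config V q) :
    embed Λ a s t = if ∀ x, x ∉ Λ → s x = t x then a (fun x => s x) (fun x => t x) else 0 := rfl

theorem embed_mul (Λ : Finset V) (a b : Op Λ q) : embed Λ a * embed Λ b = embed Λ (a * b) := by
  ext s t
  rw [Matrix.mul_apply, embed_apply]
  split_ifs with h
  · rw [Matrix.mul_apply]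
    symm
    -- Only intermediate configurations that agree with `s` outside `Λ` contribute.
    refine Fintype.sum_of_injective
      (fun (g : Config Λ q) (x : V) => if hx : x ∈ Λ then g ⟨x, hx⟩ else s x) ?_ _ _ ?_ ?_
    · intro g g' hg
      funext x
      simpa using congrFun hg x
    · intro u hu
      rw [embed_apply, if_neg, zero_mul]
      intro hsu
      refine hu ⟨fun x => u x, funext fun x => ?_⟩
      by_cases hx : x ∈ Λ
      · simp [hx]
      · simp [hx, hsu x hx]
    · intro g
      rw [embed_apply, embed_apply, if_pos fun x hx => by simp [hx],
        if_pos fun x hx => by simp [hx, h x hx]]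
      simp
  · refine Finset.sum_eq_zero fun u _ => ?_
    rw [embed_apply, embed_apply]
    split_ifs with h1 h2
    · exact absurd (fun x hx => (h1 x hx).trans (h2 x hx)) h
    all_goals simp

/-- A single intermediate configuration survives: `t` on `Λ₁` and `s` elsewhere. The resulting
formula is symmetric in the two factors, which yields commutation. -/
theorem embed_mul_embed_apply {Λ₁ Λ₂ : Finset V} (h : Disjoint Λ₁ Λ₂) (a : Op Λ₁ q) (b : Op Λ₂ q)
    (s t : Config V q) : (embed Λ₁ a * embed Λ₂ b) s t =
      if ∀ x, x ∉ Λ₁ → x ∉ Λ₂ → s x = t x then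
        a (fun x => s x) (fun x => t x) * b (fun x => s x) (fun x => t x) else 0 := by
  rw [Matrix.mul_apply, Finset.sum_eq_single fun x => if x ∈ Λ₁ then t x else s x]
  · have h2 : ∀ x ∈ Λ₂, x ∉ Λ₁ := fun x hx hx' => Finset.disjoint_left.1 h hx' hx
    have hb : (fun x : Λ₂ => if (x : V) ∈ Λ₁ then t x else s x) = fun x : Λ₂ => s x :=
      funext fun x => if_neg (h2 x x.2)
    have ha : (fun x : Λ₁ => if (x : V) ∈ Λ₁ then t x else s x) = fun x : Λ₁ => t x :=
      funext fun x => if_pos x.2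
    rw [embed_apply, embed_apply, if_pos fun x hx => by simp [hx], ha, hb, mul_ite, mul_zero]
    refine if_congr (forall_congr' fun x => ?_) rfl rfl
    by_cases hx : x ∈ Λ₁ <;> simp [hx]
  · intro u _ hu
    rw [embed_apply, embed_apply]
    split_ifs with h1 h2
    · refine absurd (funext fun x => ?_) hu
      split_ifs with hx
      · exact h2 x fun hx' => Finset.disjoint_left.1 h hx hx'
      · exact (h1 x hx).symm
    all_goals simp
  · simp

namespace ActsOn

variable {Λ Λ₁ Λ₂ : Finset V} {X Y : Op V q}

theorem commute (h : Disjoint Λ₁ Λ₂) (hX : ActsOn Λ₁ X) (hY : ActsOn Λ₂ Y) : Commute X Y := by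
  obtain ⟨a, rfl⟩ := hX
  obtain ⟨b, rfl⟩ := hY
  refine Matrix.ext fun s t => ?_
  rw [embed_mul_embed_apply h, embed_mul_embed_apply h.symm, mul_comm]
  exact if_congr (forall_congr' fun x => ⟨fun h h1 h2 => h h2 h1, fun h h1 h2 => h h2 h1⟩) rfl rfl

theorem mul (hX : ActsOn Λ X) (hY : ActsOn Λ Y) : ActsOn Λ (X * Y) := by
  obtain ⟨a, rfl⟩ := hX
  obtain ⟨b, rfl⟩ := hY
  exact ⟨a * b, embed_mul Λ a b⟩

theorem one (Λ : Finset V) : ActsOn Λ (1 : Op V q) := by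
  refine ⟨1, Matrix.ext fun s t => ?_⟩
  rw [embed_apply, Matrix.one_apply, Matrix.one_apply, ← ite_and]
  refine if_congr ⟨?_, ?_⟩ rfl rfl
  · rintro rfl
    exact ⟨fun _ _ => rfl, rfl⟩
  · rintro ⟨h1, h2⟩
    funext x
    by_cases hx : x ∈ Λ
    · exact congrFun h2 ⟨x, hx⟩
    · exact h1 x hx

theorem zero (Λ : Finset V) : ActsOn Λ (0 : Op V q) :=
  ⟨0, Matrix.ext fun s t => by simp [embed_apply]⟩

theorem add (hX : ActsOn Λ X) (hY : ActsOn Λ Y) : ActsOn Λ (X + Y) := by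
  obtain ⟨a, rfl⟩ := hX
  obtain ⟨b, rfl⟩ := hY
  refine ⟨a + b, Matrix.ext fun s t => ?_⟩
  simp only [Matrix.add_apply, embed_apply]
  split_ifs <;> simp

theorem smul (c : ℂ) (hX : ActsOn Λ X) : ActsOn Λ (c • X) := by
  obtain ⟨a, rfl⟩ := hX
  refine ⟨c • a, Matrix.ext fun s t => ?_⟩
  simp only [Matrix.smul_apply, embed_apply]
  split_ifs <;> simp

theorem sub (hX : ActsOn Λ X) (hY : ActsOn Λ Y) : ActsOn Λ (X - Y) := by
  rw [sub_eq_add_neg, ← neg_one_smul ℂ Y]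
  exact hX.add (hY.smul _)

theorem conjTranspose (hX : ActsOn Λ X) : ActsOn Λ X.conjTranspose := by
  obtain ⟨a, rfl⟩ := hX
  refine ⟨a.conjTranspose, Matrix.ext fun s t => ?_⟩
  rw [Matrix.conjTranspose_apply, embed_apply, embed_apply, Matrix.conjTranspose_apply,
    apply_ite star, star_zero]
  exact if_congr (forall_congr' fun x => forall_congr' fun _ => eq_comm) rfl rfl

theorem mono (h : Λ₁ ⊆ Λ₂) (hX : ActsOn Λ₁ X) : ActsOn Λ₂ X := by
  obtain ⟨a, rfl⟩ := hX
  refine ⟨Matrix.of fun s t => if ∀ x : Λ₂, (x : V) ∉ Λ₁ → s x = t x then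
    a (fun x => s ⟨x, h x.2⟩) (fun x => t ⟨x, h x.2⟩) else 0, Matrix.ext fun s t => ?_⟩
  rw [embed_apply, embed_apply, Matrix.of_apply, ← ite_and]
  refine if_congr ⟨fun H => ⟨fun x hx => H x fun hx' => hx (h hx'), fun x hx => H x hx⟩, ?_⟩ rfl rfl
  rintro ⟨H1, H2⟩ x hx
  by_cases hx2 : x ∈ Λ₂
  · exact H2 ⟨x, hx2⟩ hx
  · exact H1 x hx2

theorem exists_eq_smul_one (hX : ActsOn (∅ : Finset V) X) : ∃ c : ℂ, X = c • 1 := by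
  obtain ⟨a, rfl⟩ := hX
  refine ⟨a (fun x => absurd x.2 (Finset.notMem_empty _)) (fun x => absurd x.2 (Finset.notMem_empty _)),
    Matrix.ext fun s t => ?_⟩
  rw [embed_apply, Matrix.smul_apply, Matrix.one_apply, smul_eq_mul, mul_ite, mul_one, mul_zero]
  refine if_congr ⟨fun h => funext fun x => h x (by simp), fun h x _ => congrFun h x⟩ ?_ rfl
  congr 1 <;> exact funext fun x => absurd x.2 (Finset.notMem_empty _)

theorem list_prod {L : List (Op V q)} (h : ∀ X ∈ L, ActsOn Λ X) : ActsOn Λ L.prod := by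
  induction L with
  | nil => exact one Λ
  | cons X L ih =>
    rw [List.prod_cons]
    exact (h X (by simp)).mul (ih fun Y hY => h Y (by simp [hY]))

end ActsOn

end Region

/-! ### Expectation values -/

section Expectation

variable {V : Type*} [Fintype V] [DecidableEq V] {q : ℕ} {ω : Op V q}

/-- The expectation value as a linear functional. -/
def expectationLM (ω : Op V q) : Op V q →ₗ[ℂ] ℂ where
  toFun := expectation ω
  map_add' X Y := by simp [expectation, mul_add]
  map_smul' c X := by simp [expectation]

theorem expectation_sub (X Y : Op V q) :
    expectation ω (X - Y) = expectation ω X - expectation ω Y := map_sub (expectationLM ω) X Y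

theorem expectation_add (X Y : Op V q) :
    expectation ω (X + Y) = expectation ω X + expectation ω Y := map_add (expectationLM ω) X Y

theorem expectation_smul (c : ℂ) (X : Op V q) : expectation ω (c • X) = c * expectation ω X :=
  map_smul (expectationLM ω) c X

theorem expectation_sum {ι : Type*} (s : Finset ι) (X : ι → Op V q) :
    expectation ω (∑ i ∈ s, X i) = ∑ i ∈ s, expectation ω (X i) := map_sum (expectationLM ω) X s

theorem continuous_expectation (ω : Op V q) : Continuous (expectation ω) :=
  (expectationLM ω).continuous_of_finiteDimensional

theorem IsState.expectation_one (hω : IsState ω) : expectation ω 1 = 1 := by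
  rw [expectation, mul_one, hω.2]

theorem IsState.expectation_conjTranspose (hω : IsState ω) (X : Op V q) :
    expectation ω X.conjTranspose = star (expectation ω X) := by
  have h : ω * X.conjTranspose = (X * ω).conjTranspose := by
    rw [Matrix.conjTranspose_mul, hω.1.isHermitian.eq]
  rw [expectation, expectation, h, Matrix.trace_conjTranspose, Matrix.trace_mul_comm]

theorem norm_star_dotProduct_mulVec_le {n : Type*} [Fintype n] [DecidableEq n] (X : Matrix n n ℂ)
    (v : n → ℂ) : ‖star v ⬝ᵥ X.mulVec v‖ ≤ ‖X‖ * (star v ⬝ᵥ v).re := by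
  have h1 : star v ⬝ᵥ X.mulVec v = inner ℂ (WithLp.toLp 2 v) (WithLp.toLp 2 (X.mulVec v)) := by
    rw [EuclideanSpace.inner_eq_star_dotProduct, dotProduct_comm]
  have h2 : (star v ⬝ᵥ v).re = ‖WithLp.toLp 2 v‖ * ‖WithLp.toLp 2 v‖ := by
    rw [← inner_self_eq_norm_mul_norm (𝕜 := ℂ), EuclideanSpace.inner_eq_star_dotProduct,
      dotProduct_comm]
    rfl
  rw [h1, h2]
  calc _ ≤ ‖WithLp.toLp 2 v‖ * ‖WithLp.toLp 2 (X.mulVec v)‖ := norm_inner_le_norm _ _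
    _ ≤ ‖WithLp.toLp 2 v‖ * (‖X‖ * ‖WithLp.toLp 2 v‖) := by
      gcongr
      exact X.l2_opNorm_mulVec (WithLp.toLp 2 v)
    _ = _ := by ring

/-- Write `ω` as a sum of rank-one operators v v*. The squared lengths of the vectors sum to `Tr ω =
1`, so the mean is an average of quadratic forms. -/
theorem IsState.norm_expectation_le (hω : IsState ω) (X : Op V q) : ‖expectation ω X‖ ≤ ‖X‖ := by
  obtain ⟨m, v, hv⟩ := Matrix.posSemidef_iff_eq_sum_vecMulVec.1 hω.1
  have h1 : ∀ Y : Op V q, expectation ω Y = ∑ i, star (v i) ⬝ᵥ Y.mulVec (v i) := by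
    intro Y
    rw [expectation, hv, Finset.sum_mul, Matrix.trace_sum]
    refine Finset.sum_congr rfl fun i _ => ?_
    rw [Matrix.trace_mul_comm, Matrix.mul_vecMulVec, Matrix.trace_vecMulVec, dotProduct_comm]
  have h2 : ∑ i, (star (v i) ⬝ᵥ v i).re = 1 := by
    have := h1 1
    simp only [hω.expectation_one, Matrix.one_mulVec] at this
    rw [← Complex.re_sum, ← this, Complex.one_re]
  calc ‖expectation ω X‖ ≤ ∑ i, ‖star (v i) ⬝ᵥ X.mulVec (v i)‖ := by
        rw [h1]
        exact norm_sum_le _ _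
    _ ≤ ∑ i, ‖X‖ * (star (v i) ⬝ᵥ v i).re :=
        Finset.sum_le_sum fun i _ => norm_star_dotProduct_mulVec_le X (v i)
    _ = ‖X‖ := by rw [← Finset.mul_sum, h2, mul_one]

theorem norm_one_le : ‖(1 : Op V q)‖ ≤ 1 := by
  rcases subsingleton_or_nontrivial (Op V q) with h | h
  · rw [Subsingleton.elim (1 : Op V q) 0, norm_zero]
    exact zero_le_one
  · exact CStarRing.norm_one.le

/-- Exponential decay of correlations for a centred observable and an arbitrary operator. -/
theorem HasCorrelationLength.norm_expectation_mul_le [MetricSpace V] {ξ C l : ℝ} (hξ : 0 < ξ)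
    (hC : 0 < C) (hω : IsState ω) (hcorr : HasCorrelationLength ω ξ C) {Λ₁ Λ₂ : Finset V}
    (hdisj : Disjoint Λ₁ Λ₂) (hfar : ∀ x ∈ Λ₁, ∀ y ∈ Λ₂, l ≤ dist x y) {X Y : Op V q}
    (hX : IsObservableOn Λ₁ X) (hX0 : expectation ω X = 0) (hY : ActsOn Λ₂ Y) :
    ‖expectation ω (X * Y)‖ ≤ C * ‖X‖ * ‖Y‖ * Real.exp (-(l / ξ)) := by
  have hnn : 0 ≤ C * ‖X‖ * ‖Y‖ * Real.exp (-(l / ξ)) := by positivity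
  -- Decay of correlations is assumed for nonempty regions only; an operator on the empty region is
  -- a scalar.
  rcases Λ₁.eq_empty_or_nonempty with rfl | h1
  · obtain ⟨c, rfl⟩ := hX.2.exists_eq_smul_one
    rw [expectation_smul, hω.expectation_one, mul_one] at hX0
    simp [hX0, expectation]
  rcases Λ₂.eq_empty_or_nonempty with rfl | h2
  · obtain ⟨c, rfl⟩ := hY.exists_eq_smul_one
    rw [mul_smul_comm, mul_one, expectation_smul, hX0, mul_zero, norm_zero]
    exact hnn
  set z := expectation ω (X * Y) with hz
  -- `Y` need not be self-adjoint. Rotate it by a phase so that the mean becomes real and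
  -- nonnegative, then pass to the Hermitian part `W`.
  obtain ⟨u, hu, huz⟩ : ∃ u : ℂ, ‖u‖ = 1 ∧ u * z = ‖z‖ := by
    by_cases h0 : z = 0
    · exact ⟨1, by simp, by simp [h0]⟩
    · have h0' : (‖z‖ : ℂ) ≠ 0 := by simpa using h0
      refine ⟨star z / ‖z‖, by simp [h0], ?_⟩
      rw [div_mul_eq_mul_div, div_eq_iff h0', ← sq]
      exact Complex.conj_mul' z
  set W : Op V q := (1 / 2 : ℂ) • (u • Y + (u • Y).conjTranspose) with hW
  have hWobs : IsObservableOn Λ₂ W := by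
    refine ⟨?_, (((hY.smul u).add (hY.smul u).conjTranspose).smul _)⟩
    rw [Matrix.IsHermitian, hW, Matrix.conjTranspose_smul, Matrix.conjTranspose_add,
      Matrix.conjTranspose_conjTranspose, add_comm]
    simp
  have hWn : ‖W‖ ≤ ‖Y‖ := by
    have h3 : ‖u • Y‖ ≤ ‖Y‖ := by rw [norm_smul, hu, one_mul]
    calc ‖W‖ ≤ ‖(1 / 2 : ℂ)‖ * ‖u • Y + (u • Y).conjTranspose‖ := by rw [hW, norm_smul]
      _ ≤ ‖(1 / 2 : ℂ)‖ * (‖u • Y‖ + ‖u • Y‖) := by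
        gcongr
        refine (norm_add_le _ _).trans ?_
        rw [Matrix.l2_opNorm_conjTranspose]
      _ ≤ ‖Y‖ := by
        norm_num
        linarith
  -- Disjoint supports make the second half of `X * W` the adjoint of the first, so both halves have
  -- the mean `‖z‖`.
  have hcomm : X * (u • Y).conjTranspose = (X * (u • Y)).conjTranspose := by
    rw [Matrix.conjTranspose_mul, hX.1.eq]
    exact (hX.2.commute hdisj (hY.smul u).conjTranspose).eq
  have hexp : expectation ω (X * W) = ‖z‖ := by
    rw [hW, mul_smul_comm, mul_add, expectation_smul, expectation_add, hcomm,
      hω.expectation_conjTranspose, mul_smul_comm, expectation_smul, ← hz, huz]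
    simp
    ring
  have key := hcorr Λ₁ Λ₂ h1 h2 hdisj X W hX hWobs
  rw [hX0, zero_mul, sub_zero, hexp, Complex.norm_real, norm_norm] at key
  have hdist : l ≤ regionDist Λ₁ Λ₂ := by
    have : Nonempty (Λ₁ × Λ₂) := ⟨⟨⟨_, h1.choose_spec⟩, ⟨_, h2.choose_spec⟩⟩⟩
    exact le_ciInf fun p => hfar _ p.1.2 _ p.2.2
  refine key.trans ?_
  gcongr

end Expectation

/-! ### Powers of sums -/

section Products

theorem sum_pow_eq_sum_prod_ofFn {R ι : Type*} [Semiring R] [Fintype ι] (h : ι → R) (m : ℕ) :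
    (∑ i, h i) ^ m = ∑ f : Fin m → ι, (List.ofFn fun i => h (f i)).prod := by
  induction m with
  | zero => simp
  | succ m ih =>
    rw [pow_succ', ih, Finset.sum_mul_sum, ← (Fin.consEquiv fun _ : Fin (m + 1) => ι).sum_comp,
      Fintype.sum_prod_type]
    simp [List.ofFn_succ, Fin.consEquiv]

/-- Putting 1 in place of the extracted factor keeps the index type `Fin m`. -/
theorem prod_ofFn_eq_mul_update {M : Type*} [Monoid M] {m : ℕ} (g : Fin m → M) (i : Fin m)
    (h : ∀ j, Commute (g i) (g j)) :
    (List.ofFn g).prod = g i * (List.ofFn (Function.update g i 1)).prod := by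
  induction m with
  | zero => exact i.elim0
  | succ m ih =>
    rw [List.ofFn_succ, List.ofFn_succ, List.prod_cons, List.prod_cons]
    refine Fin.cases (fun h => ?_) (fun i h => ?_) i h
    · simp [Function.update_of_ne]
    · have hs : (fun j : Fin m => Function.update g i.succ 1 j.succ) =
          Function.update (fun j : Fin m => g j.succ) i 1 := by
        funext j
        simp [Function.update_apply]
      rw [hs, ih (fun j => g j.succ) i fun j => h j.succ,
        Function.update_of_ne (Fin.succ_ne_zero i).symm, ← mul_assoc, ← mul_assoc, (h 0).eq]

theorem norm_prod_ofFn_le {V : Type*} [Fintype V] [DecidableEq V] {q m : ℕ} (g : Fin m → Op V q)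
    {b : Fin m → ℝ} (h : ∀ i, ‖g i‖ ≤ b i) : ‖(List.ofFn g).prod‖ ≤ ∏ i, b i := by
  induction m with
  | zero => simpa using norm_one_le
  | succ m ih =>
    rw [List.ofFn_succ, List.prod_cons, Fin.prod_univ_succ]
    refine (norm_mul_le _ _).trans ?_
    exact mul_le_mul (h 0) (ih _ fun i => h i.succ) (norm_nonneg _) ((norm_nonneg _).trans (h 0))

end Products

/-! ### Weights on regions -/

section Weights

open Finset

variable {V : Type*} [Fintype V] [DecidableEq V]

/-- Two regions that contain points at distance at most `l`. -/
def Near [MetricSpace V] (l : ℝ) (Λ₁ Λ₂ : Finset V) : Prop :=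
  ∃ x ∈ Λ₁, ∃ y ∈ Λ₂, dist x y ≤ l

theorem Near.symm [MetricSpace V] {l : ℝ} ⦃Λ₁ Λ₂ : Finset V⦄ (h : Near l Λ₁ Λ₂) :
    Near l Λ₂ Λ₁ := by
  obtain ⟨x, hx, y, hy, hxy⟩ := h
  exact ⟨y, hy, x, hx, dist_comm x y ▸ hxy⟩

variable {w : Finset V → ℝ} {L : ℝ}

theorem sum_card_mul_le (hL : ∀ x, ∑ Λ with x ∈ Λ, w Λ ≤ L) :
    ∑ Λ, (#Λ : ℝ) * w Λ ≤ Fintype.card V * L := by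
  calc ∑ Λ, (#Λ : ℝ) * w Λ = ∑ Λ : Finset V, ∑ x, if x ∈ Λ then w Λ else 0 := by
        refine sum_congr rfl fun Λ _ => ?_
        simp
    _ = ∑ x, ∑ Λ with x ∈ Λ, w Λ := by
        rw [sum_comm]
        simp only [sum_filter]
    _ ≤ ∑ _x : V, L := sum_le_sum fun x _ => hL x
    _ = _ := by simp

/-- No spin sees the empty region, so its weight must vanish; every other region is counted at least
once by its spins. -/
theorem sum_weight_le (hw : ∀ Λ, 0 ≤ w Λ) (hw0 : w ∅ = 0) (hL : ∀ x, ∑ Λ with x ∈ Λ, w Λ ≤ L) :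
    ∑ Λ, w Λ ≤ Fintype.card V * L := by
  refine le_trans (sum_le_sum fun Λ _ => ?_) (sum_card_mul_le hL)
  rcases Λ.eq_empty_or_nonempty with rfl | h
  · simp [hw0]
  · exact le_mul_of_one_le_left (hw Λ) (by exact_mod_cast card_pos.2 h)

variable [MetricSpace V] {l M : ℝ}

-- A union bound over a point of `Λ` and a point of its `l`-ball: at most `#Λ * M` pairs, each
-- carrying weight at most `L`.
open Classical in
theorem sum_near_le (hw : ∀ Λ, 0 ≤ w Λ) (hL0 : 0 ≤ L) (hL : ∀ x, ∑ Λ with x ∈ Λ, w Λ ≤ L)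
    (hM : ∀ x : V, (#{y | dist x y ≤ l} : ℝ) ≤ M) (Λ : Finset V) :
    ∑ Λ' with Near l Λ Λ', w Λ' ≤ #Λ * (M * L) := by
  calc ∑ Λ' with Near l Λ Λ', w Λ'
      ≤ ∑ Λ', ∑ x ∈ Λ, ∑ y with dist x y ≤ l, if y ∈ Λ' then w Λ' else 0 := by
        rw [sum_filter]
        refine sum_le_sum fun Λ' _ => ?_
        have hnn : ∀ y, 0 ≤ if y ∈ Λ' then w Λ' else 0 := fun y => by
          split_ifs
          exacts [hw Λ', le_rfl]
        split_ifs with h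
        · obtain ⟨x, hx, y, hy, hxy⟩ := h
          refine le_trans ?_ (single_le_sum
            (f := fun x => ∑ y with dist x y ≤ l, if y ∈ Λ' then w Λ' else 0)
            (fun x _ => sum_nonneg fun y _ => hnn y) hx)
          refine le_trans ?_ (single_le_sum (fun y _ => hnn y) (by simpa using hxy))
          rw [if_pos hy]
        · exact sum_nonneg fun x _ => sum_nonneg fun y _ => hnn y
    _ = ∑ x ∈ Λ, ∑ y with dist x y ≤ l, ∑ Λ' with y ∈ Λ', w Λ' := by
        rw [sum_comm]
        refine sum_congr rfl fun x _ => ?_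
        rw [sum_comm]
        simp only [sum_filter]
    _ ≤ ∑ x ∈ Λ, ∑ y with dist x y ≤ l, L := sum_le_sum fun x _ => sum_le_sum fun y _ => hL y
    _ ≤ ∑ x ∈ Λ, M * L := by
        refine sum_le_sum fun x _ => ?_
        rw [sum_const, nsmul_eq_mul]
        exact mul_le_mul_of_nonneg_right (hM x) hL0
    _ = _ := by simp

/-- The leaves contribute (#Λ M L)^j for a centre Λ. One factor #Λ is kept, to be summed against the
weight by `sum_card_mul_le`, and the other j - 1 are bounded by k. This is where j ≥ 1 matters and
where the prefactor n/k arises. -/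
theorem starSum_near_le {k : ℕ} (hk : 1 ≤ k) (hw : ∀ Λ, 0 ≤ w Λ)
    (hwk : ∀ Λ, k < #Λ → w Λ = 0) (hM0 : 0 ≤ M) (hL0 : 0 ≤ L)
    (hL : ∀ x, ∑ Λ with x ∈ Λ, w Λ ≤ L) (hM : ∀ x : V, (#{y | dist x y ≤ l} : ℝ) ≤ M) {j : ℕ}
    (hj : 1 ≤ j) {α : Type*} [Fintype α] [DecidableEq α] (c : α) (hα : Fintype.card α = j + 1) :
    starSum (Near l) w c ≤ (Fintype.card V : ℝ) / k * L * (k * M * L) ^ j := by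
  classical
  obtain ⟨j, rfl⟩ := Nat.exists_eq_add_of_le' hj
  rw [starSum_eq, hα, Nat.add_sub_cancel]
  have hk0 : (k : ℝ) ≠ 0 := by
    have : k ≠ 0 := by omega
    exact_mod_cast this
  calc ∑ Λ, w Λ * (∑ Λ' with Near l Λ Λ', w Λ') ^ (j + 1)
      ≤ ∑ Λ : Finset V, (#Λ * w Λ) * ((k : ℝ) ^ j * (M * L) ^ (j + 1)) := by
        refine sum_le_sum fun Λ _ => ?_
        rcases lt_or_ge k (#Λ) with h | h
        · simp [hwk Λ h]
        · have h' : (#Λ : ℝ) ≤ k := by exact_mod_cast h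
          calc w Λ * (∑ Λ' with Near l Λ Λ', w Λ') ^ (j + 1)
              ≤ w Λ * (#Λ * (M * L)) ^ (j + 1) :=
                mul_le_mul_of_nonneg_left (pow_le_pow_left₀ (sum_nonneg fun Λ' _ => hw Λ')
                  (sum_near_le hw hL0 hL hM Λ) _) (hw Λ)
            _ = (#Λ * w Λ) * ((#Λ : ℝ) ^ j * (M * L) ^ (j + 1)) := by ring
            _ ≤ _ := by
                have := hw Λ
                gcongr
    _ ≤ (Fintype.card V * L) * ((k : ℝ) ^ j * (M * L) ^ (j + 1)) := by
        rw [← sum_mul]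
        exact mul_le_mul_of_nonneg_right (sum_card_mul_le hL) (by positivity)
    _ = _ := by
        field_simp
        ring

theorem sum_linkedSum_near_le {k : ℕ} (hk : 1 ≤ k) (hw : ∀ Λ, 0 ≤ w Λ)
    (hwk : ∀ Λ, k < #Λ → w Λ = 0) (hM0 : 0 ≤ M) (hL0 : 0 ≤ L)
    (hL : ∀ x, ∑ Λ with x ∈ Λ, w Λ ≤ L) (hM : ∀ x : V, (#{y | dist x y ≤ l} : ℝ) ≤ M) (N : ℕ) :
    ∑ m ∈ range N, linkedSum (Near l) w (Fin m) / m.factorial ≤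
      Real.exp ((Fintype.card V : ℝ) / k * L * (Real.exp (k * M * L) - 1 - k * M * L / 2)) := by
  refine sum_div_factorial_le_exp (T := fun m => linkedSum (Near l) w (Fin m))
    (fun m => linkedSum_nonneg _ hw _) ?_ (by positivity) (by positivity) (fun m => ?_) N
  · rw [linkedSum, Fintype.sum_unique]
    split_ifs
    · simp
    · exact zero_le_one
  · exact linkedSum_succ_le Near.symm hw
      (fun j hj α _ _ c hα => starSum_near_le hk hw hwk hM0 hL0 hL hM hj c hα) m

end Weights

/-! ### The moment bound -/

section Moments

open Finset

variable {V : Type*} [Fintype V] [DecidableEq V] [MetricSpace V] {q : ℕ} {ω : Op V q}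
  {ξ C l : ℝ}

theorem norm_expectation_prod_le_of_not_linked (hξ : 0 < ξ) (hC : 0 < C) (hω : IsState ω)
    (hcorr : HasCorrelationLength ω ξ C) (hl : 0 ≤ l) {g : Finset V → Op V q}
    (hg : ∀ Λ, IsObservableOn Λ (g Λ)) (hg0 : ∀ Λ, expectation ω (g Λ) = 0) {m : ℕ}
    {f : Fin m → Finset V} (hf : ¬ Linked (Near l) f) :
    ‖expectation ω (List.ofFn fun i => g (f i)).prod‖ ≤
      C * Real.exp (-(l / ξ)) * ∏ i, ‖g (f i)‖ := by
  rw [Linked] at hf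
  push Not at hf
  obtain ⟨i, hi⟩ := hf
  -- Isolation makes region `i` disjoint from the others, because `l ≥ 0`. Hence its factor commutes
  -- with the whole product.
  have hfar : ∀ j, j ≠ i → ∀ x ∈ f i, ∀ y ∈ f j, l < dist x y := by
    intro j hj x hx y hy
    by_contra h
    exact hi j hj ⟨x, hx, y, hy, not_lt.1 h⟩
  have hdisj : ∀ j, j ≠ i → Disjoint (f i) (f j) := by
    intro j hj
    refine disjoint_left.2 fun x hx hx' => ?_
    have := hfar j hj x hx x hx'
    rw [dist_self] at this
    exact absurd this (not_lt.2 hl)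
  have hcomm : ∀ j, Commute (g (f i)) (g (f j)) := by
    intro j
    by_cases hj : j = i
    · rw [hj]
    · exact (hg _).2.commute (hdisj j hj) (hg _).2
  rw [prod_ofFn_eq_mul_update _ i hcomm]
  set P := (List.ofFn (Function.update (fun j => g (f j)) i 1)).prod with hP
  have hPact : ActsOn ((univ.erase i).biUnion f) P := by
    refine ActsOn.list_prod fun X hX => ?_
    obtain ⟨j, rfl⟩ := List.mem_ofFn.1 hX
    by_cases hj : j = i
    · rw [hj, Function.update_self]
      exact ActsOn.one _
    · rw [Function.update_of_ne hj]
      exact (hg _).2.mono (subset_biUnion_of_mem f (by simp [hj]))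
  have hPn : ‖g (f i)‖ * ‖P‖ ≤ ∏ j, ‖g (f j)‖ := by
    have h1 : ‖P‖ ≤ ∏ j, Function.update (fun j => ‖g (f j)‖) i 1 j := by
      refine norm_prod_ofFn_le _ fun j => ?_
      by_cases hj : j = i
      · rw [hj, Function.update_self, Function.update_self]
        exact norm_one_le
      · rw [Function.update_of_ne hj, Function.update_of_ne hj]
    rw [prod_update_of_mem (mem_univ i), one_mul] at h1
    rw [← mul_prod_erase _ _ (mem_univ i), ← sdiff_singleton_eq_erase]
    exact mul_le_mul_of_nonneg_left h1 (norm_nonneg _)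
  have key := hcorr.norm_expectation_mul_le (l := l) hξ hC hω (Λ₁ := f i)
    (Λ₂ := (univ.erase i).biUnion f)
    ((disjoint_biUnion_right _ _ _).2 fun j hj => hdisj j (ne_of_mem_erase hj))
    (fun x hx y hy => by
      obtain ⟨j, hj, hyj⟩ := mem_biUnion.1 hy
      exact (hfar j (ne_of_mem_erase hj) x hx y hyj).le) (hg _) (hg0 _) hPact
  calc _ ≤ C * ‖g (f i)‖ * ‖P‖ * Real.exp (-(l / ξ)) := key
    _ = C * Real.exp (-(l / ξ)) * (‖g (f i)‖ * ‖P‖) := by ring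
    _ ≤ _ := by gcongr

/-- Linked tuples are bounded by the product of norms and unlinked ones by decay of correlations;
the latter sum is then extended to all tuples, giving a full power. -/
theorem norm_expectation_pow_le (hξ : 0 < ξ) (hC : 0 < C) (hω : IsState ω)
    (hcorr : HasCorrelationLength ω ξ C) (hl : 0 ≤ l) {g : Finset V → Op V q}
    (hg : ∀ Λ, IsObservableOn Λ (g Λ)) (hg0 : ∀ Λ, expectation ω (g Λ) = 0) (m : ℕ) :
    ‖expectation ω ((∑ Λ, g Λ) ^ m)‖ ≤ linkedSum (Near l) (fun Λ => ‖g Λ‖) (Fin m) +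
      C * Real.exp (-(l / ξ)) * (∑ Λ, ‖g Λ‖) ^ m := by
  classical
  have hpow : (∑ Λ, ‖g Λ‖) ^ m = ∑ f : Fin m → Finset V, ∏ i, ‖g (f i)‖ := by
    rw [sum_pow', Fintype.piFinset_univ]
  rw [sum_pow_eq_sum_prod_ofFn, expectation_sum, hpow, mul_sum, linkedSum, ← sum_add_distrib]
  refine (norm_sum_le _ _).trans (sum_le_sum fun f _ => ?_)
  have hpr : 0 ≤ ∏ i, ‖g (f i)‖ := prod_nonneg fun i _ => norm_nonneg _
  split_ifs with hf
  · refine ((hω.norm_expectation_le _).trans (norm_prod_ofFn_le _ fun i => le_rfl)).trans ?_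
    exact le_add_of_nonneg_right (by positivity)
  · rw [zero_add]
    exact norm_expectation_prod_le_of_not_linked hξ hC hω hcorr hl hg hg0 hf

theorem norm_expectation_exp_le {k : ℕ} (hk : 1 ≤ k) (hξ : 0 < ξ) (hC : 0 < C) (hω : IsState ω)
    (hcorr : HasCorrelationLength ω ξ C) (hl : 0 ≤ l) {g : Finset V → Op V q}
    (hg : ∀ Λ, IsObservableOn Λ (g Λ)) (hg0 : ∀ Λ, expectation ω (g Λ) = 0)
    (hgk : ∀ Λ, k < #Λ → g Λ = 0) {L M : ℝ} (hM0 : 0 ≤ M) (hL0 : 0 ≤ L)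
    (hL : ∀ x, ∑ Λ with x ∈ Λ, ‖g Λ‖ ≤ L) (hM : ∀ x : V, (#{y | dist x y ≤ l} : ℝ) ≤ M) :
    ‖expectation ω (NormedSpace.exp (∑ Λ, g Λ))‖ ≤
      Real.exp ((Fintype.card V : ℝ) / k * L * (Real.exp (k * M * L) - 1 - k * M * L / 2)) +
        C * Real.exp (Fintype.card V * L - l / ξ) := by
  -- A scalar with zero mean is zero, as `sum_weight_le` requires.
  have hempty : ‖g ∅‖ = 0 := by
    obtain ⟨c, hc⟩ := (hg ∅).2.exists_eq_smul_one
    have h0 := hg0 ∅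
    rw [hc, expectation_smul, hω.expectation_one, mul_one] at h0
    rw [hc, h0, zero_smul, norm_zero]
  set w : Finset V → ℝ := fun Λ => ‖g Λ‖ with hw
  have hw0 : ∀ Λ, 0 ≤ w Λ := fun Λ => norm_nonneg _
  have hW : 0 ≤ ∑ Λ, w Λ := sum_nonneg fun Λ _ => hw0 Λ
  have hsum := (NormedSpace.exp_series_hasSum_exp' (𝕂 := ℂ) (∑ Λ, g Λ)).map (expectationLM ω)
    (continuous_expectation ω)
  refine le_of_tendsto hsum.tendsto_sum_nat.norm (Filter.Eventually.of_forall fun N => ?_)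
  calc ‖∑ m ∈ range N, (expectationLM ω ∘ fun m => ((m.factorial : ℂ)⁻¹) • (∑ Λ, g Λ) ^ m) m‖
      ≤ ∑ m ∈ range N, (linkedSum (Near l) w (Fin m) / m.factorial +
          C * Real.exp (-(l / ξ)) * ((∑ Λ, w Λ) ^ m / m.factorial)) := by
        refine (norm_sum_le _ _).trans (sum_le_sum fun m _ => ?_)
        rw [Function.comp_apply, map_smul, smul_eq_mul, norm_mul, norm_inv, Complex.norm_natCast]
        calc _ ≤ (m.factorial : ℝ)⁻¹ * _ := mul_le_mul_of_nonneg_left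
              (norm_expectation_pow_le hξ hC hω hcorr hl hg hg0 m) (by positivity)
          _ = _ := by
              ring
    _ ≤ _ := by
        rw [sum_add_distrib, ← mul_sum, sub_eq_add_neg (_ * L), Real.exp_add]
        refine add_le_add (sum_linkedSum_near_le hk hw0 (fun Λ h => by simp [hw, hgk Λ h]) hM0 hL0
          hL hM N) ?_
        have h1 := Real.sum_le_exp_of_nonneg hW N
        have h2 := Real.exp_le_exp.2 (sum_weight_le hw0 hempty hL)
        calc _ ≤ C * Real.exp (-(l / ξ)) * Real.exp (Fintype.card V * L) := by
              gcongr
              exact h1.trans h2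
          _ = _ := by ring

theorem BallGrowth.card_le {A d r₀ : ℝ} (h : BallGrowth V A d r₀) (hl : r₀ ≤ l) (x : V) :
    (#{y | dist x y ≤ l} : ℝ) ≤ A * l ^ d := by
  have := h x l hl
  rwa [← Set.ncard_coe_finset, show ((univ.filter fun y => dist x y ≤ l : Finset V) : Set V) =
    Metric.closedBall x l by ext y; simp [dist_comm]]

theorem IsState.expectation_re {X : Op V q} (hω : IsState ω) (hX : X.IsHermitian) :
    ((expectation ω X).re : ℂ) = expectation ω X := by
  have := hω.expectation_conjTranspose X
  rw [hX.eq] at this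
  exact Complex.conj_eq_iff_re.1 this.symm

theorem dependence_nonneg (h : Finset V → Op V q) : 0 ≤ dependence h :=
  mul_nonneg zero_le_two (Real.iSup_nonneg fun _ => sum_nonneg fun _ _ => norm_nonneg _)

theorem expectation_exp_le_momentBound {A d r₀ : ℝ} (hA : 0 < A) (hr₀ : 0 < r₀) (hξ : 0 < ξ)
    (hC : 0 < C) (hball : BallGrowth V A d r₀) (hω : IsState ω)
    (hcorr : HasCorrelationLength ω ξ C) {k : ℕ} (hk : 1 ≤ k) {H : Op V q} (hH : H.IsHermitian)
    (hl : r₀ ≤ l) {h : Finset V → Op V q} (hh : h ∈ kLocalDecompositions k H) :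
    (expectation ω (NormedSpace.exp H)).re ≤
      momentBound (Fintype.card V) k A d ξ C l (expectation ω H).re (dependence h) := by
  obtain ⟨⟨hobs, hsum⟩, hhk⟩ := hh
  have hl0 : 0 < l := hr₀.trans_le hl
  set L := dependence h with hLdef
  have hL0 : 0 ≤ L := dependence_nonneg h
  set M := A * l ^ d with hMdef
  have hM0 : 0 ≤ M := by positivity
  set μ := (expectation ω H).re with hμ
  set g : Finset V → Op V q := fun Λ => h Λ - expectation ω (h Λ) • 1 with hg
  have hgobs : ∀ Λ, IsObservableOn Λ (g Λ) := by
    refine fun Λ => ⟨?_, (hobs Λ).2.sub ((ActsOn.one Λ).smul _)⟩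
    rw [Matrix.IsHermitian, hg, Matrix.conjTranspose_sub, Matrix.conjTranspose_smul,
      Matrix.conjTranspose_one, (hobs Λ).1.eq, ← hω.expectation_conjTranspose, (hobs Λ).1.eq]
  have hg0 : ∀ Λ, expectation ω (g Λ) = 0 := fun Λ => by
    rw [hg, expectation_sub, expectation_smul, hω.expectation_one, mul_one, sub_self]
  have hgn : ∀ Λ, ‖g Λ‖ ≤ 2 * ‖h Λ‖ := fun Λ => by
    have h1 : ‖expectation ω (h Λ) • (1 : Op V q)‖ ≤ ‖h Λ‖ * 1 := by
      rw [norm_smul]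
      exact mul_le_mul (hω.norm_expectation_le _) norm_one_le (norm_nonneg _) (norm_nonneg _)
    have h2 := norm_sub_le (h Λ) (expectation ω (h Λ) • (1 : Op V q))
    change ‖h Λ - expectation ω (h Λ) • (1 : Op V q)‖ ≤ _
    linarith
  have hgk : ∀ Λ, k < #Λ → g Λ = 0 := fun Λ hΛ => by
    simp [hg, hhk Λ hΛ, expectation]
  have hgL : ∀ x, ∑ Λ with x ∈ Λ, ‖g Λ‖ ≤ L := fun x => by
    refine (sum_le_sum fun Λ _ => hgn Λ).trans ?_
    rw [← mul_sum, hLdef, dependence]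
    refine mul_le_mul_of_nonneg_left ?_ zero_le_two
    exact le_ciSup (f := fun x : V => ∑ Λ with x ∈ Λ, ‖h Λ‖) (Set.finite_range _).bddAbove x
  have hdecomp : H = (μ : ℂ) • 1 + ∑ Λ, g Λ := by
    rw [hμ, hω.expectation_re hH, hg, sum_sub_distrib, ← sum_smul, ← expectation_sum, ← hsum]
    abel
  have hexp : NormedSpace.exp H = (Real.exp μ : ℂ) • NormedSpace.exp (∑ Λ, g Λ) := by
    have hc : Commute ((μ : ℂ) • (1 : Op V q)) (∑ Λ, g Λ) := (Commute.one_left _).smul_left _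
    have he : NormedSpace.exp ((μ : ℂ) • (1 : Op V q)) = (Real.exp μ : ℂ) • 1 := by
      rw [← Algebra.algebraMap_eq_smul_one, ← Algebra.algebraMap_eq_smul_one,
        ← NormedSpace.algebraMap_exp_comm, Complex.ofReal_exp, Complex.exp_eq_exp_ℂ]
    conv_lhs => rw [hdecomp]
    rw [Matrix.exp_add_of_commute _ _ hc, he, smul_mul_assoc, one_mul]
  have hmain := norm_expectation_exp_le hk hξ hC hω hcorr hl0.le hgobs hg0 hgk hM0 hL0 hgL
    (hball.card_le hl)
  -- Passes from `M` to `M ^ 2`. A ball contains its centre, so `M ≥ 1`, and e^y - 1 - y/2 is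
  -- increasing for y ≥ 0.
  have hMM : (Fintype.card V : ℝ) / k * L * (Real.exp (k * M * L) - 1 - k * M * L / 2) ≤
      (Fintype.card V : ℝ) / k * (Real.exp (k * M ^ 2 * L) - 1 - k * M ^ 2 * L / 2) * L := by
    rcases isEmpty_or_nonempty V with hV | ⟨⟨v⟩⟩
    · simp
    · have hM1 : 1 ≤ M := by
        refine le_trans ?_ (hball.card_le hl v)
        exact_mod_cast card_pos.2 ⟨v, by simpa using hl0.le⟩
      set y := k * M * L with hy
      have hyy : y ≤ k * M ^ 2 * L := by
        rw [hy]
        gcongr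
        nlinarith
      have hy0 : 0 ≤ y := by positivity
      have hmono : Real.exp y - 1 - y / 2 ≤
          Real.exp (k * M ^ 2 * L) - 1 - k * M ^ 2 * L / 2 := by
        have h1 : Real.exp (k * M ^ 2 * L) = Real.exp (k * M ^ 2 * L - y) * Real.exp y := by
          rw [← Real.exp_add]
          ring_nf
        have h2 := Real.add_one_le_exp (k * M ^ 2 * L - y)
        have h3 := Real.one_le_exp hy0
        have h4 : (k * M ^ 2 * L - y) * 1 ≤ (k * M ^ 2 * L - y) * Real.exp y :=
          mul_le_mul_of_nonneg_left h3 (by linarith)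
        have h5 := mul_le_mul_of_nonneg_right h2 (Real.exp_pos y).le
        linarith
      calc _ = (Fintype.card V : ℝ) / k * (Real.exp y - 1 - y / 2) * L := by ring
        _ ≤ _ := by gcongr
  calc (expectation ω (NormedSpace.exp H)).re
      ≤ ‖expectation ω (NormedSpace.exp H)‖ := Complex.re_le_norm _
    _ = Real.exp μ * ‖expectation ω (NormedSpace.exp (∑ Λ, g Λ))‖ := by
        rw [hexp, expectation_smul, norm_mul, Complex.norm_real, Real.norm_of_nonneg
          (Real.exp_pos μ).le]
    _ ≤ Real.exp μ * (Real.exp ((Fintype.card V : ℝ) / k *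
          (Real.exp (k * M ^ 2 * L) - 1 - k * M ^ 2 * L / 2) * L) +
            C * Real.exp (Fintype.card V * L - l / ξ)) := by
        refine mul_le_mul_of_nonneg_left (hmain.trans ?_) (Real.exp_pos μ).le
        gcongr
    _ = _ := by
        rw [momentBound, Real.exp_add, add_sub_assoc, Real.exp_add μ (_ * L - _)]
        ring

/-- The terms in `IsKLocal` need not be self-adjoint; taking Hermitian parts preserves supports and
the sum `H`. -/
theorem kLocalDecompositions_nonempty {k : ℕ} {H : Op V q} (hH : H.IsHermitian)
    (hloc : IsKLocal k H) : (kLocalDecompositions k H).Nonempty := by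
  obtain ⟨Y, hY, hsum⟩ := hloc
  refine ⟨fun Λ => if #Λ ≤ k then (1 / 2 : ℂ) • (Y Λ + (Y Λ).conjTranspose) else 0,
    ⟨fun Λ => ?_, ?_⟩, fun Λ hΛ => if_neg (not_le.2 hΛ)⟩
  · dsimp only
    split_ifs
    · refine ⟨?_, ((hY Λ).add (hY Λ).conjTranspose).smul _⟩
      rw [Matrix.IsHermitian, Matrix.conjTranspose_smul, Matrix.conjTranspose_add,
        Matrix.conjTranspose_conjTranspose, add_comm]
      simp
    · exact ⟨Matrix.isHermitian_zero, ActsOn.zero Λ⟩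
  · rw [← sum_filter, ← smul_sum, sum_add_distrib, ← Matrix.conjTranspose_sum, ← hsum, hH.eq,
      ← two_smul ℂ H, smul_smul]
    norm_num

theorem continuous_momentBound (n k : ℕ) (A d ξ C l m : ℝ) :
    Continuous (momentBound n k A d ξ C l m) := by
  unfold momentBound
  fun_prop

end Moments

end SpinSystem

theorem mainTheorem4 {V : Type*} [Fintype V] [DecidableEq V] [MetricSpace V] {q : ℕ}
    (A d r₀ ξ C : ℝ) (hA : 0 < A) (hd : 1 ≤ d) (hr₀ : 0 < r₀) (hξ : 0 < ξ) (hC : 0 < C)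
    (hball : SpinSystem.BallGrowth V A d r₀)
    (ω : SpinSystem.Op V q) (hω : SpinSystem.IsState ω)
    (hcorr : SpinSystem.HasCorrelationLength ω ξ C)
    (k : ℕ) (hk : 1 ≤ k) (H : SpinSystem.Op V q) (hH : H.IsHermitian)
    (hloc : SpinSystem.IsKLocal k H) (l : ℝ) (hl : r₀ ≤ l) :
    (SpinSystem.expectation ω (NormedSpace.exp H)).re ≤
        SpinSystem.momentBound (Fintype.card V) k A d ξ C l
          (SpinSystem.expectation ω H).re (SpinSystem.kLocalNorm k H) ∧
      ((∃ h ∈ SpinSystem.kLocalDecompositions k H,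
          SpinSystem.dependence h = SpinSystem.localNorm H) →
        (SpinSystem.expectation ω (NormedSpace.exp H)).re ≤
          SpinSystem.momentBound (Fintype.card V) k A d ξ C l
            (SpinSystem.expectation ω H).re (SpinSystem.localNorm H)) := by
  have key : ∀ h ∈ SpinSystem.kLocalDecompositions k H,
      (SpinSystem.expectation ω (NormedSpace.exp H)).re ≤
        SpinSystem.momentBound (Fintype.card V) k A d ξ C l
          (SpinSystem.expectation ω H).re (SpinSystem.dependence h) := fun h hh =>
    SpinSystem.expectation_exp_le_momentBound hA hr₀ hξ hC hball hω hcorr hk hH hl hh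
  refine ⟨?_, ?_⟩
  -- Attainment of the minimum is not needed: the bound is a closed condition on `L`, and the
  -- infimum is a limit of values for which it holds.
  · have hmem : SpinSystem.kLocalNorm k H ∈
        closure (SpinSystem.dependence '' SpinSystem.kLocalDecompositions k H) := by
      refine csInf_mem_closure ((SpinSystem.kLocalDecompositions_nonempty hH hloc).image _)
        ⟨0, ?_⟩
      rintro _ ⟨h, -, rfl⟩
      exact SpinSystem.dependence_nonneg h
    have hclosed := isClosed_le
      (continuous_const (y := (SpinSystem.expectation ω (NormedSpace.exp H)).re))
      (SpinSystem.continuous_momentBound (Fintype.card V) k A d ξ C l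
        (SpinSystem.expectation ω H).re)
    refine closure_minimal ?_ hclosed hmem
    rintro _ ⟨h, hh, rfl⟩
    exact key h hh
  · rintro ⟨h, hh, heq⟩
    rw [← heq]
    exact key h hh
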